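/- For $n\ge 1$ let $Q_n$ be the hypercube, i.e. the graph on the binary strings of length $n$ in which two strings are adjacent if and only if they differ in exactly one position, and let the folded hypercube $FQ_n$ be obtained from $Q_n$ by adding every edge that joins a string $u_1\cdots u_n$ to its complement $\bar u_1\cdots\bar u_n$, where $\bar u_i=1-u_i$. Let $K_{1,r}$ be the star with $r$ leaves. For graphs $G$ and $T$, a $T$-structure-cut (respectively, $T$-substructure-cut) of $G$ is a set $F$ of subgraphs of $G$, each isomorphic to $T$ (respectively, to a connected subgraph of $T$), such that the graph $G-F$, obtained from $G$ by deleting the vertices of all members of $F$, is disconnected, i.e. has at least two components. The members of $F$ need not be disjoint. The $T$-structure connectivity $\kappa(G;T)$ (respectively, $T$-substructure connectivity $\kappa^s(G;T)$) is the minimum cardinality of a $T$-structure-cut (respectively, $T$-substructure-cut) of $G$. For integers $r\ge 2$ define $$g(r)=\begin{cases}\max\left\{6,\ \dfrac{r+5}{2},\ \dfrac{r^2+4r-5}{8}\right\}, & r \text{ odd},\\[2ex] \max\left\{6,\ \dfrac{r^2+2r-8}{8},\ \dfrac{r+6}{2},\ \dfrac{r^2+6r}{12}\right\}, & r\text{ even}.\end{cases}$$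 **Theorem.** For all integers $r\ge 2$ and $n>g(r)$, $$\kappa(FQ_n;K_{1,r})=\kappa^s(FQ_n;K_{1,r})=\left\lceil\frac{n+1}{2}\right\rceil .$$ -/

import Mathlib

/-- The `n`-dimensional hypercube `Q_n`: binary strings of length `n`, two of them being adjacent
when they differ in exactly one position. -/
def hypercubeGraph (n : ℕ) : SimpleGraph (Fin n → Bool) where
  Adj u v := hammingDist u v = 1
  symm := ⟨fun u v h => by rw [hammingDist_comm]; exact h⟩
  loopless := ⟨fun u h => by simp at h⟩

/-- The folded hypercube `FQ_n`: the hypercube `Q_n` together with all the edges joining a string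
to its bitwise complement. -/
def foldedHypercube (n : ℕ) : SimpleGraph (Fin n → Bool) :=
  hypercubeGraph n ⊔ SimpleGraph.fromRel fun u v => v = fun i => !(u i)

/-- The star `K_{1,r}` with `r` leaves. -/
abbrev starK (r : ℕ) : SimpleGraph (Fin 1 ⊕ Fin r) :=
  completeBipartiteGraph (Fin 1) (Fin r)

section StructureConnectivity

variable {V W : Type*}

/-- `G - F`: the graph obtained from `G` by deleting the vertices of all members of `F`. -/
def deleteSubgraphs (G : SimpleGraph V) (F : Set G.Subgraph) :
    SimpleGraph ↥((⋃ H ∈ F, H.verts)ᶜ) :=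
  G.induce (⋃ H ∈ F, H.verts)ᶜ

/-- `F` is a `T`-structure-cut of `G`: each member of `F` is isomorphic to `T`, and `G - F` is
disconnected. (A graph is not preconnected exactly when it has at least two components; in
particular the graph without vertices does not count as disconnected.) -/
def IsStructureCut (G : SimpleGraph V) (T : SimpleGraph W) (F : Set G.Subgraph) : Prop :=
  (∀ H ∈ F, Nonempty (H.coe ≃g T)) ∧ ¬ (deleteSubgraphs G F).Preconnected

/-- `F` is a `T`-substructure-cut of `G`: each member of `F` is isomorphic to a connected subgraph
of `T`, and `G - F` is disconnected. -/
def IsSubstructureCut (G : SimpleGraph V) (T : SimpleGraph W) (F : Set G.Subgraph) : Prop :=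
  (∀ H ∈ F, ∃ T' : T.Subgraph, T'.Connected ∧ Nonempty (H.coe ≃g T'.coe)) ∧
    ¬ (deleteSubgraphs G F).Preconnected

/-- The `T`-structure connectivity `κ(G; T)`: the minimum cardinality of a `T`-structure-cut
(`⊤` if there is none). -/
noncomputable def structureConnectivity (G : SimpleGraph V) (T : SimpleGraph W) : ℕ∞ :=
  sInf {k : ℕ∞ | ∃ F : Set G.Subgraph, IsStructureCut G T F ∧ F.encard = k}

/-- The `T`-substructure connectivity `κˢ(G; T)`: the minimum cardinality of a
`T`-substructure-cut (`⊤` if there is none). -/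
noncomputable def substructureConnectivity (G : SimpleGraph V) (T : SimpleGraph W) : ℕ∞ :=
  sInf {k : ℕ∞ | ∃ F : Set G.Subgraph, IsSubstructureCut G T F ∧ F.encard = k}

end StructureConnectivity

/-- The threshold function `g(r)`, for `r ≥ 2`. -/
def starThreshold (r : ℕ) : ℚ :=
  if Odd r then
    max 6 (max (((r : ℚ) + 5) / 2) (((r : ℚ) ^ 2 + 4 * r - 5) / 8))
  else
    max 6 (max (((r : ℚ) ^ 2 + 2 * r - 8) / 8)
      (max (((r : ℚ) + 6) / 2) (((r : ℚ) ^ 2 + 6 * r) / 12)))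

/-!
In `FQ_n` every closed walk of odd length is longer than `n`, and two vertices have at most two
common neighbours. Hence a star contains at most two neighbours of a vertex outside it, and even at
most two vertices of the joint neighbourhood of two adjacent vertices outside it. So deleting at
most `n / 2` stars leaves no component with fewer than `n + 2` vertices. By induction on `n`,
cutting the hypercube into two slices, a vertex set that separates two sets of at least `n + 2`
vertices has more than `n.choose 2` vertices, too many for `n / 2` stars.

Conversely, split the `n + 1` neighbours of a vertex `u` into pairs, reusing a neighbour if `n` is
even. The two vertices of a pair have a common neighbour other than `u`, which is the centre of a
star through both that misses `u`; these `⌈(n + 1) / 2⌉` stars isolate `u`.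
-/

section Isoperimetry

open Finset

variable {n m k : ℕ}

/-- No vertex of `A` is equal or adjacent in the hypercube to a vertex of `B`, so that
`(A ∪ B)ᶜ` separates `A` from `B`. -/
def HammingSeparated (A B : Finset (Fin n → Bool)) : Prop :=
  ∀ u ∈ A, ∀ v ∈ B, 1 < hammingDist u v

/-- The slice of `A` on which the first coordinate is `b`, as a subset of the smaller cube. -/
def cubeSlice (b : Bool) (A : Finset (Fin (m + 1) → Bool)) : Finset (Fin m → Bool) :=
  {v | Fin.cons b v ∈ A}

/-- The separator `(A ∪ B)ᶜ` has more than `k n - k (k + 1) / 2` vertices; among the sets of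
`k ≤ n` vertices, those contained in a ball of radius one around one of their vertices show that
this is the smallest possible boundary. -/
def SeparatorBound (A B : Finset (Fin n → Bool)) (k : ℕ) : Prop :=
  k * n < (k + 1).choose 2 + #(A ∪ B)ᶜ

theorem mem_cubeSlice {b : Bool} {A : Finset (Fin (m + 1) → Bool)} {v : Fin m → Bool} :
    v ∈ cubeSlice b A ↔ Fin.cons b v ∈ A := by
  simp [cubeSlice]

theorem cubeSlice_compl_union (b : Bool) (A B : Finset (Fin (m + 1) → Bool)) :
    cubeSlice b (A ∪ B)ᶜ = (cubeSlice b A ∪ cubeSlice b B)ᶜ := by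
  ext v
  simp [mem_cubeSlice]

theorem card_cubeSlice_add_card_cubeSlice_not (b : Bool) (A : Finset (Fin (m + 1) → Bool)) :
    #(cubeSlice b A) + #(cubeSlice (!b) A) = #A := by
  have h : ∑ c, #(cubeSlice c A) = #A := by
    simp only [cubeSlice, card_filter, ← Fintype.sum_prod_type']
    exact (Fintype.sum_equiv (Fin.consEquiv fun _ => Bool) _ (fun v => if v ∈ A then 1 else 0)
      fun _ => rfl).trans (by simp)
  rw [← h, Fintype.sum_bool]
  cases b
  · exact add_comm _ _
  · rfl

theorem card_separator_cubeSlice_add (b : Bool) (A B : Finset (Fin (m + 1) → Bool)) :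
    #(cubeSlice b A ∪ cubeSlice b B)ᶜ + #(cubeSlice (!b) A ∪ cubeSlice (!b) B)ᶜ = #(A ∪ B)ᶜ := by
  rw [← cubeSlice_compl_union, ← cubeSlice_compl_union, card_cubeSlice_add_card_cubeSlice_not]

theorem hammingDist_cons (a b : Bool) (u v : Fin m → Bool) :
    hammingDist (Fin.cons a u : Fin (m + 1) → Bool) (Fin.cons b v) =
      (if a = b then 0 else 1) + hammingDist u v := by
  simp [hammingDist, card_filter, Fin.sum_univ_succ, ite_not]

namespace HammingSeparated

theorem symm {A B : Finset (Fin n → Bool)} (h : HammingSeparated A B) : HammingSeparated B A :=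
  fun u hu v hv => hammingDist_comm v u ▸ h v hv u hu

theorem card_add_card_add_card_separator {A B : Finset (Fin n → Bool)}
    (h : HammingSeparated A B) : #A + #B + #(A ∪ B)ᶜ = 2 ^ n := by
  have hAB : Disjoint A B := disjoint_left.2 fun v hv hv' => by simpa using h v hv v hv'
  rw [← card_union_of_disjoint hAB, card_add_card_compl]
  simp

theorem slice {A B : Finset (Fin (m + 1) → Bool)} (h : HammingSeparated A B) (b : Bool) :
    HammingSeparated (cubeSlice b A) (cubeSlice b B) := fun u hu v hv => by
  simpa [hammingDist_cons] using h _ (mem_cubeSlice.1 hu) _ (mem_cubeSlice.1 hv)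

theorem disjoint_cubeSlice_not {A B : Finset (Fin (m + 1) → Bool)} (h : HammingSeparated A B)
    (b : Bool) : Disjoint (cubeSlice b A) (cubeSlice (!b) B) :=
  disjoint_left.2 fun v hv hv' => by
    simpa [hammingDist_cons] using h _ (mem_cubeSlice.1 hv) _ (mem_cubeSlice.1 hv')

theorem card_cubeSlice_add_card_cubeSlice_not_le {A B : Finset (Fin (m + 1) → Bool)}
    (h : HammingSeparated A B) (b : Bool) : #(cubeSlice b A) + #(cubeSlice (!b) B) ≤ 2 ^ m := by
  rw [← card_union_of_disjoint (h.disjoint_cubeSlice_not b)]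
  exact (card_le_univ _).trans (by simp)

theorem card_cubeSlice_le {A B : Finset (Fin (m + 1) → Bool)} (h : HammingSeparated A B)
    (b : Bool) :
    #(cubeSlice b A) ≤ #(cubeSlice (!b) A) + #(cubeSlice (!b) A ∪ cubeSlice (!b) B)ᶜ := by
  have h₁ := h.card_cubeSlice_add_card_cubeSlice_not_le b
  have h₂ := (h.slice (!b)).card_add_card_add_card_separator
  lia

end HammingSeparated

theorem choose_two_add_add_one (i j : ℕ) :
    (i + j + 1).choose 2 = (i + 1).choose 2 + (j + 1).choose 2 + i * j := by
  induction j with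
  | zero => simp
  | succ j ih =>
    rw [← add_assoc, Nat.choose_succ_succ' (i + j + 1), Nat.choose_succ_succ' (j + 1), ih]
    simp only [Nat.choose_one_right]
    ring

namespace SeparatorBound

theorem symm {A B : Finset (Fin n → Bool)} (h : SeparatorBound A B k) : SeparatorBound B A k := by
  rwa [SeparatorBound, union_comm]

variable {A B : Finset (Fin (m + 1) → Bool)} {b : Bool}

theorem of_slices {i j : ℕ} (hi : 1 ≤ i) (hj : 1 ≤ j)
    (h₀ : SeparatorBound (cubeSlice b A) (cubeSlice b B) i)
    (h₁ : SeparatorBound (cubeSlice (!b) A) (cubeSlice (!b) B) j) :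
    SeparatorBound A B (i + j) := by
  have hij : i + j ≤ i * j + 1 := by nlinarith
  have hS := card_separator_cubeSlice_add b A B
  rw [SeparatorBound] at *
  rw [choose_two_add_add_one]
  linarith

theorem of_slice (h : SeparatorBound (cubeSlice b A) (cubeSlice b B) k)
    (hk : k ≤ #(cubeSlice (!b) A ∪ cubeSlice (!b) B)ᶜ) : SeparatorBound A B k := by
  have hS := card_separator_cubeSlice_add b A B
  rw [SeparatorBound] at *
  linarith

theorem of_slice_succ (h : SeparatorBound (cubeSlice b A) (cubeSlice b B) k)
    (hm : m ≤ #(cubeSlice (!b) A ∪ cubeSlice (!b) B)ᶜ) : SeparatorBound A B (k + 1) := by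
  have hS := card_separator_cubeSlice_add b A B
  have hk := choose_two_add_add_one k 1
  rw [SeparatorBound] at *
  simp only [Nat.choose_self] at hk
  linarith

theorem of_card_add_card_lt (h : HammingSeparated A B)
    (hk : k * (m + 2) ≤ (k + 1).choose 2 + 2 ^ m) (hAB : #A + #B < k + 2 ^ m) :
    SeparatorBound A B k := by
  have hS := h.card_add_card_add_card_separator
  rw [SeparatorBound]
  rw [pow_succ] at hS
  linarith

end SeparatorBound

namespace HammingSeparated

theorem separatorBound_card_left : ∀ {n : ℕ} {A B : Finset (Fin n → Bool)},
    HammingSeparated A B → A.Nonempty → SeparatorBound A B #A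
  | 0, A, B, _, hA => by
    have h₁ : 1 ≤ #A := hA.card_pos
    have h₂ : #A ≤ 1 := (card_le_univ A).trans (by simp)
    simp [SeparatorBound, le_antisymm h₂ h₁]
  | m + 1, A, B, h, hA => by
    have of_empty (b : Bool) (hb : cubeSlice (!b) A = ∅) : SeparatorBound A B #A := by
      have hs := h.card_cubeSlice_le b
      have hc := card_cubeSlice_add_card_cubeSlice_not b A
      rw [hb, card_empty, add_zero] at hc
      rw [hb, card_empty, zero_add, ← hb, hc] at hs
      have hA' : (cubeSlice b A).Nonempty := card_pos.1 (hc ▸ hA.card_pos)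
      exact .of_slice (hc ▸ (h.slice b).separatorBound_card_left hA') hs
    rcases (cubeSlice false A).eq_empty_or_nonempty with h₀ | h₀
    · exact of_empty true h₀
    rcases (cubeSlice true A).eq_empty_or_nonempty with h₁ | h₁
    · exact of_empty false h₁
    rw [← card_cubeSlice_add_card_cubeSlice_not false A]
    exact .of_slices h₀.card_pos h₁.card_pos ((h.slice _).separatorBound_card_left h₀)
      ((h.slice _).separatorBound_card_left h₁)

theorem dim_le_card_separator : ∀ {n : ℕ} {A B : Finset (Fin n → Bool)},
    HammingSeparated A B → A.Nonempty → B.Nonempty → n ≤ #(A ∪ B)ᶜ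
  | 0, _, _, _, _, _ => Nat.zero_le _
  | m + 1, A, B, h, hA, hB => by
    have hS := card_separator_cubeSlice_add false A B
    have hA := card_cubeSlice_add_card_cubeSlice_not false A ▸ hA.card_pos
    have hB := card_cubeSlice_add_card_cubeSlice_not false B ▸ hB.card_pos
    have ih (b : Bool) : #(cubeSlice b A) = 0 ∨ #(cubeSlice b B) = 0 ∨
        m ≤ #(cubeSlice b A ∪ cubeSlice b B)ᶜ := by
      simp only [card_eq_zero, ← not_nonempty_iff_eq_empty]
      have := @dim_le_card_separator _ _ _ (h.slice b)
      tauto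
    have ih₀ := ih false
    have ih₁ := ih true
    have hs₀ := (h.slice false).card_add_card_add_card_separator
    have hs₁ := (h.slice true).card_add_card_add_card_separator
    have hAB := h.card_cubeSlice_add_card_cubeSlice_not_le false
    have hBA := h.card_cubeSlice_add_card_cubeSlice_not_le true
    have hm : m < 2 ^ m := Nat.lt_two_pow_self
    have : m = 0 → 2 ^ m = 1 := by rintro rfl; rfl
    simp only [Bool.not_false, Bool.not_true] at *
    -- If no slice meets both sides, then `A` and `B` lie in different slices and together have at
    -- most `2 ^ m` vertices.
    lia

end HammingSeparated

theorem mul_le_choose_two_add_two_pow (hkm : k ≤ m) (hk : k + 4 ≤ 2 * m) :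
    k * (m + 2) ≤ (k + 1).choose 2 + 2 ^ m := by
  rcases lt_or_ge m 4 with hm | hm
  · interval_cases m <;> interval_cases k <;> revert hk <;> decide
  have diag : m * (m + 2) ≤ (m + 1).choose 2 + 2 ^ m := by
    clear hkm hk
    induction m, hm using Nat.le_induction with
    | base => decide
    | succ m hm ih =>
      have hm' : m + 2 ≤ 2 ^ m := by
        have := (m - 2).lt_two_pow_self
        obtain ⟨i, rfl⟩ := Nat.exists_eq_add_of_le' (by lia : 2 ≤ m)
        lia
      rw [Nat.choose_succ_succ' (m + 1), Nat.choose_one_right, pow_succ]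
      linarith
  obtain ⟨d, rfl⟩ := Nat.exists_eq_add_of_le hkm
  have hd := Nat.add_one_mul_choose_eq d 1
  rw [choose_two_add_add_one] at diag
  rw [Nat.choose_one_right] at hd
  nlinarith

theorem SeparatorBound.of_balanced_slices {A B : Finset (Fin (m + 1) → Bool)}
    (hk : 2 ≤ k) (hkm : k ≤ m) (hm : k + 4 ≤ 2 * m) (hA : k ≤ #A) (hB : k ≤ #B)
    (hAB : k + 2 ^ m ≤ #A + #B) (h : HammingSeparated A B)
    (hA₁ : ∀ b, 1 ≤ #(cubeSlice b A) ∧ k + 2 ≤ m + #(cubeSlice b A))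
    (hB₁ : ∀ b, 1 ≤ #(cubeSlice b B) ∧ k + 2 ≤ m + #(cubeSlice b B))
    (ih : ∀ b j, 1 ≤ j → j + 2 ≤ m → j ≤ #(cubeSlice b A) → j ≤ #(cubeSlice b B) →
      SeparatorBound (cubeSlice b A) (cubeSlice b B) j) : SeparatorBound A B k := by
  obtain ⟨i, j, hi, hj, rfl, hij⟩ : ∃ i j, 1 ≤ i ∧ 1 ≤ j ∧ i + j = k ∧
      i + 2 ≤ m ∧ j + 2 ≤ m ∧ i ≤ #(cubeSlice false A) ∧ i ≤ #(cubeSlice false B) ∧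
        j ≤ #(cubeSlice true A) ∧ j ≤ #(cubeSlice true B) := by
    have hA₀ := card_cubeSlice_add_card_cubeSlice_not false A
    have hB₀ := card_cubeSlice_add_card_cubeSlice_not false B
    have hAB₀ := h.card_cubeSlice_add_card_cubeSlice_not_le false
    have hAB₁ := h.card_cubeSlice_add_card_cubeSlice_not_le true
    rw [Bool.forall_bool] at hA₁ hB₁
    simp only [Bool.not_false, Bool.not_true] at *
    -- With `i` as large as possible, `hAB` makes `k - i` fit in the other slice.
    obtain ⟨i, hi⟩ : ∃ i, i = min (min #(cubeSlice false A) #(cubeSlice false B))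
      (min (m - 2) (k - 1)) := ⟨_, rfl⟩
    refine ⟨i, k - i, ?_⟩
    omega
  exact .of_slices hi hj (ih false i hi hij.1 hij.2.2.1 hij.2.2.2.1)
    (ih true j hj hij.2.1 hij.2.2.2.2.1 hij.2.2.2.2.2)

namespace HammingSeparated

theorem separatorBound_of_cubeSlice_eq_empty {A B : Finset (Fin (m + 1) → Bool)} {b : Bool}
    (h : HammingSeparated A B) (hAb : cubeSlice (!b) A = ∅) (hk : 2 ≤ k) (hkm : k < m)
    (hA : k < #A)
    (ih : ∀ j, 1 ≤ j → j + 2 ≤ m → j ≤ #(cubeSlice b A) → j ≤ #(cubeSlice b B) →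
      SeparatorBound (cubeSlice b A) (cubeSlice b B) j) : SeparatorBound A B k := by
  have hs := h.card_cubeSlice_le b
  have hA' := card_cubeSlice_add_card_cubeSlice_not b A
  have hB' := card_cubeSlice_add_card_cubeSlice_not b B
  have hAB := h.card_cubeSlice_add_card_cubeSlice_not_le b
  rw [hAb, card_empty] at hA' hs
  rw [← hAb] at hs
  rcases lt_or_ge #(cubeSlice b B) k with hBk | hBk
  · exact .of_card_add_card_lt h (mul_le_choose_two_add_two_pow hkm.le (by lia)) (by lia)
  rcases Nat.lt_or_ge (k + 1) m with hkm' | hkm'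
  · exact .of_slice (ih k (by lia) (by lia) (by lia) hBk) (by lia)
  · obtain ⟨j, rfl⟩ : ∃ j, k = j + 1 := ⟨k - 1, by lia⟩
    exact .of_slice_succ (ih j (by lia) (by lia) (by lia) (by lia)) (by lia)

theorem separatorBound_of_le_card : ∀ {n k : ℕ} {A B : Finset (Fin n → Bool)},
    HammingSeparated A B → 1 ≤ k → k + 2 ≤ n → k ≤ #A → k ≤ #B → SeparatorBound A B k
  | 0, _, _, _, _, _, hkn, _, _ => by lia
  | m + 1, k, A, B, h, hk, hkn, hA, hB => by
    have ih (b : Bool) (j : ℕ) : 1 ≤ j → j + 2 ≤ m → j ≤ #(cubeSlice b A) →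
        j ≤ #(cubeSlice b B) → SeparatorBound (cubeSlice b A) (cubeSlice b B) j :=
      (h.slice b).separatorBound_of_le_card
    rcases hk.eq_or_lt with rfl | hk
    · have := h.dim_le_card_separator (card_pos.1 hA) (card_pos.1 hB)
      rw [SeparatorBound, Nat.choose_self]
      lia
    rcases hA.eq_or_lt with rfl | hA
    · exact h.separatorBound_card_left (card_pos.1 (by lia))
    rcases hB.eq_or_lt with rfl | hB
    · exact (h.symm.separatorBound_card_left (card_pos.1 (by lia))).symm
    by_cases hAe : ∃ b, cubeSlice (!b) A = ∅
    · obtain ⟨b, hb⟩ := hAe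
      exact h.separatorBound_of_cubeSlice_eq_empty hb hk (by lia) hA (ih b)
    by_cases hBe : ∃ b, cubeSlice (!b) B = ∅
    · obtain ⟨b, hb⟩ := hBe
      exact (h.symm.separatorBound_of_cubeSlice_eq_empty hb hk (by lia) hB
        fun j h₁ h₂ h₃ h₄ => (ih b j h₁ h₂ h₄ h₃).symm).symm
    rcases lt_or_ge (#A + #B) (k + 2 ^ m) with hAB | hAB
    · exact .of_card_add_card_lt h (mul_le_choose_two_add_two_pow (by lia) (by lia)) hAB
    have pos_of (C : Finset (Fin (m + 1) → Bool)) (hC : ¬ ∃ b, cubeSlice (!b) C = ∅) (b : Bool) :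
        1 ≤ #(cubeSlice b C) ∧ k + 2 ≤ m + #(cubeSlice b C) := by
      have : 0 < #(cubeSlice b C) :=
        card_pos.2 (nonempty_iff_ne_empty.2 fun hb => hC ⟨!b, by rwa [Bool.not_not]⟩)
      lia
    exact .of_balanced_slices hk (by lia) (by lia) hA.le hB.le hAB h (pos_of A hAe)
      (pos_of B hBe) ih

theorem choose_two_le_card_separator {A B : Finset (Fin n → Bool)} (h : HammingSeparated A B)
    (hn : 3 ≤ n) (hA : n ≤ #A + 2) (hB : n ≤ #B + 2) : n.choose 2 ≤ #(A ∪ B)ᶜ := by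
  obtain ⟨k, rfl⟩ := Nat.exists_eq_add_of_le' (m := 2) (by lia : 2 ≤ n)
  have hb := h.separatorBound_of_le_card (k := k) (by lia) le_rfl (by lia) (by lia)
  have hc := Nat.add_one_mul_choose_eq k 1
  rw [SeparatorBound] at hb
  rw [Nat.choose_succ_succ' (k + 1), Nat.choose_one_right]
  rw [Nat.choose_one_right] at hc
  nlinarith

theorem choose_two_lt_of_card_cubeSlice_le_one {A B : Finset (Fin (m + 1) → Bool)} {b : Bool}
    (h : HammingSeparated A B) (hm : 3 ≤ m) (hA : m + 3 ≤ #A) (hAB : m + 2 ^ m ≤ #A + #B)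
    (hAb : #(cubeSlice (!b) A) ≤ 1) : (m + 1).choose 2 < #(A ∪ B)ᶜ := by
  have hS := card_separator_cubeSlice_add b A B
  have hs := h.card_cubeSlice_le b
  have hA' := card_cubeSlice_add_card_cubeSlice_not b A
  have hB' := card_cubeSlice_add_card_cubeSlice_not b B
  have hAB' := h.card_cubeSlice_add_card_cubeSlice_not_le b
  have hc := (h.slice b).choose_two_le_card_separator hm (by lia) (by lia)
  rw [Nat.choose_succ_succ', Nat.choose_one_right]
  lia

theorem choose_two_lt_card_separator {A B : Finset (Fin n → Bool)} (h : HammingSeparated A B)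
    (hn : 5 ≤ n) (hA : n + 2 ≤ #A) (hB : n + 2 ≤ #B) : n.choose 2 < #(A ∪ B)ᶜ := by
  obtain ⟨m, rfl⟩ := Nat.exists_eq_add_of_le' (m := 1) (by lia : 1 ≤ n)
  have hm := Nat.add_one_mul_choose_eq m 1
  rw [Nat.choose_one_right] at hm
  rcases lt_or_ge (#A + #B) (m + 2 ^ m) with hAB | hAB
  · have hb : SeparatorBound A B m :=
      .of_card_add_card_lt h (mul_le_choose_two_add_two_pow le_rfl (by lia)) hAB
    rw [SeparatorBound] at hb
    nlinarith
  by_cases hA₁ : ∃ b, #(cubeSlice (!b) A) ≤ 1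
  · obtain ⟨b, hb⟩ := hA₁
    exact h.choose_two_lt_of_card_cubeSlice_le_one (by lia) hA hAB hb
  by_cases hB₁ : ∃ b, #(cubeSlice (!b) B) ≤ 1
  · obtain ⟨b, hb⟩ := hB₁
    rw [union_comm]
    exact h.symm.choose_two_lt_of_card_cubeSlice_le_one (by lia) hB (by lia) hb
  have two_le_of (C : Finset (Fin (m + 1) → Bool)) (hC : ¬ ∃ b, #(cubeSlice (!b) C) ≤ 1) (b) :
      1 ≤ #(cubeSlice b C) ∧ m + 2 ≤ m + #(cubeSlice b C) := by
    have : 1 < #(cubeSlice b C) := not_le.1 fun hb => hC ⟨!b, by rwa [Bool.not_not]⟩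
    lia
  have hb : SeparatorBound A B m :=
    .of_balanced_slices (by lia) le_rfl (by lia) (by lia) (by lia) hAB h (two_le_of A hA₁)
      (two_le_of B hB₁) fun b _ => (h.slice b).separatorBound_of_le_card
  rw [SeparatorBound] at hb
  nlinarith

end HammingSeparated

end Isoperimetry

section FoldedHypercube

open Finset
open scoped symmDiff

variable {n : ℕ}

theorem hammingDist_compl_add (u v : Fin n → Bool) : hammingDist uᶜ v + hammingDist u v = n := by
  have h := card_filter_add_card_filter_not (s := univ) fun i => u i = v i
  rw [card_univ, Fintype.card_fin] at h
  simpa [hammingDist, Bool.not_eq] using h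

theorem even_hammingDist_add (u v w : Fin n → Bool) :
    Even (hammingDist u v + hammingDist v w + hammingDist u w) := by
  simp only [hammingDist, card_filter, ← sum_add_distrib]
  refine even_sum _ fun i _ => ?_
  cases u i <;> cases v i <;> cases w i <;> decide

/-- The set of coordinates flipped along an edge of the folded hypercube: all of them for `none`,
only the `i`-th one for `some i`. -/
def foldedDirection (s : Option (Fin n)) : Fin n → Bool :=
  fun j => s = none ∨ s = some j

theorem hammingDist_eq_one_iff {u v : Fin n → Bool} :
    hammingDist u v = 1 ↔ ∃ i, v = u ∆ foldedDirection (some i) := by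
  rw [hammingDist, card_eq_one]
  refine exists_congr fun i => ?_
  simp only [Finset.ext_iff, funext_iff]
  refine forall_congr' fun j => ?_
  simp only [ne_eq, mem_filter, mem_univ, true_and, mem_singleton, Pi.symmDiff_apply,
    foldedDirection, reduceCtorEq, Option.some.injEq, eq_comm (a := i), false_or,
    Bool.symmDiff_eq_xor]
  by_cases h : j = i <;> simp [h, eq_comm, Bool.eq_not]

theorem foldedHypercube_adj_iff (hn : 0 < n) {u v : Fin n → Bool} :
    (foldedHypercube n).Adj u v ↔ hammingDist u v = 1 ∨ v = uᶜ := by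
  have hc (w : Fin n → Bool) : (fun i => !w i) = wᶜ := rfl
  have : Nonempty (Fin n) := ⟨⟨0, hn⟩⟩
  simp only [foldedHypercube, SimpleGraph.sup_adj, SimpleGraph.fromRel_adj, hc]
  refine or_congr Iff.rfl ⟨?_, ?_⟩
  · rintro ⟨-, rfl | rfl⟩ <;> simp
  · rintro rfl
    exact ⟨ne_compl_self, Or.inl rfl⟩

theorem foldedHypercube_adj_iff_exists (hn : 0 < n) {u v : Fin n → Bool} :
    (foldedHypercube n).Adj u v ↔ ∃ s, v = u ∆ foldedDirection s := by
  have h : (foldedDirection none : Fin n → Bool) = ⊤ := by ext; simp [foldedDirection]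
  rw [foldedHypercube_adj_iff hn, hammingDist_eq_one_iff, Option.exists, h, symmDiff_top,
    hnot_eq_compl, or_comm]

theorem foldedHypercube_walk_length (hn : 0 < n) {u v : Fin n → Bool}
    (p : (foldedHypercube n).Walk u v) :
    (hammingDist u v ≤ p.length ∧ Even (p.length + hammingDist u v)) ∨
      (n < hammingDist u v + p.length ∧ Odd (p.length + n + hammingDist u v)) := by
  induction p with
  | nil => simp
  | @cons u v w huv p ih =>
    have hv := hammingDist_le_card_fintype (x := v) (y := w)
    rw [Fintype.card_fin] at hv
    simp only [SimpleGraph.Walk.length_cons, Nat.even_iff, Nat.odd_iff] at *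
    rcases (foldedHypercube_adj_iff hn).1 huv with huv | rfl
    · have h₁ := hammingDist_triangle u v w
      have h₂ := hammingDist_triangle v u w
      have h₃ := Nat.even_iff.1 (even_hammingDist_add u v w)
      rw [hammingDist_comm v u] at h₂
      lia
    · have := hammingDist_compl_add u w
      lia

theorem lt_length_of_odd (hn : 0 < n) {v : Fin n → Bool} (p : (foldedHypercube n).Walk v v)
    (hp : Odd p.length) : n < p.length := by
  have := foldedHypercube_walk_length hn p
  rw [hammingDist_self, Nat.even_iff] at this
  rw [Nat.odd_iff] at hp
  lia

theorem foldedDirection_injective (hn : 2 ≤ n) :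
    Function.Injective (foldedDirection : Option (Fin n) → Fin n → Bool) := by
  have : Nontrivial (Fin n) := Fin.nontrivial_iff_two_le.2 hn
  intro s t h
  have h' (j) : (s = none ∨ s = some j) ↔ (t = none ∨ t = some j) :=
    decide_eq_decide.1 (congrFun h j)
  rcases s with _ | i <;> rcases t with _ | j
  · rfl
  · obtain ⟨k, hk⟩ := exists_ne j
    simpa [hk.symm] using h' k
  · obtain ⟨k, hk⟩ := exists_ne i
    simpa [hk.symm] using h' k
  · simpa [eq_comm] using h' i

theorem eq_or_eq_of_symmDiff_foldedDirection (hn : 5 ≤ n) {s t s' t' : Option (Fin n)}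
    (hst : s' ≠ t')
    (h : foldedDirection s ∆ foldedDirection t = foldedDirection s' ∆ foldedDirection t') :
    s' = s ∨ s' = t := by
  have h' (j) : ((decide (s = none ∨ s = some j)) ^^ decide (t = none ∨ t = some j)) =
      (decide (s' = none ∨ s' = some j) ^^ decide (t' = none ∨ t' = some j)) := by
    simpa [foldedDirection] using congrFun h j
  obtain ⟨k, hk⟩ : ∃ k, some k ∉ ({s, t, s', t'} : Finset (Option (Fin n))) := by
    by_contra! hall
    have := card_le_card_of_injOn some (s := univ) (fun k _ => hall k)
      (Option.some_injective _).injOn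
    have := this.trans card_le_four
    rw [card_univ, Fintype.card_fin] at this
    lia
  simp only [mem_insert, mem_singleton, not_or] at hk
  have := h' k
  rcases s' with _ | i
  · grind
  · have := h' i
    grind

theorem isRegularOfDegree_foldedHypercube (hn : 2 ≤ n) [DecidableRel (foldedHypercube n).Adj] :
    (foldedHypercube n).IsRegularOfDegree (n + 1) := fun u => by
  have h : (foldedHypercube n).neighborFinset u = univ.image fun s => u ∆ foldedDirection s := by
    ext v
    simp [foldedHypercube_adj_iff_exists (by lia : 0 < n), eq_comm]
  rw [← SimpleGraph.card_neighborFinset_eq_degree, h, card_image_of_injective, card_univ,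
    Fintype.card_option, Fintype.card_fin]
  exact (symmDiff_right_injective u).comp (foldedDirection_injective hn)

theorem card_neighborFinset_inter_le_two (hn : 5 ≤ n) [DecidableRel (foldedHypercube n).Adj]
    {u v : Fin n → Bool} (huv : u ≠ v) :
    #((foldedHypercube n).neighborFinset u ∩ (foldedHypercube n).neighborFinset v) ≤ 2 := by
  have hn' : 0 < n := by lia
  have hmem (w) : w ∈ (foldedHypercube n).neighborFinset u ∩ (foldedHypercube n).neighborFinset v ↔
      ∃ s t, w = u ∆ foldedDirection s ∧ w = v ∆ foldedDirection t := by
    simp [foldedHypercube_adj_iff_exists hn']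
  rcases eq_empty_or_nonempty
    ((foldedHypercube n).neighborFinset u ∩ (foldedHypercube n).neighborFinset v) with h₀ | ⟨w, hw⟩
  · simp [h₀]
  obtain ⟨s, t, hs, ht⟩ := (hmem w).1 hw
  refine (card_le_card fun w' hw' => ?_).trans
    (card_le_two (a := u ∆ foldedDirection s) (b := u ∆ foldedDirection t))
  obtain ⟨s', t', hs', ht'⟩ := (hmem w').1 hw'
  have symmDiff_eq {x a b : Fin n → Bool} (ha : x = u ∆ a) (hb : x = v ∆ b) : a ∆ b = u ∆ v := by
    rw [← symmDiff_symmDiff_cancel_right a u, ← symmDiff_symmDiff_cancel_right b v, ← ha, ← hb,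
      symmDiff_symmDiff_symmDiff_comm, symmDiff_self, bot_symmDiff]
  have hst' : s' ≠ t' := by
    rintro rfl
    exact huv (symmDiff_left_injective _ (hs'.symm.trans ht'))
  rcases eq_or_eq_of_symmDiff_foldedDirection hn hst'
    ((symmDiff_eq hs ht).trans (symmDiff_eq hs' ht').symm) with rfl | rfl <;> simp [hs']

end FoldedHypercube

section Stars

open Finset

variable {V : Type*} {G : SimpleGraph V}

/-- `S` is the vertex set of a (possibly trivial) star of `G` centred at `c`. -/
def IsStarAt (G : SimpleGraph V) (c : V) (S : Finset V) : Prop :=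
  c ∈ S ∧ ∀ w ∈ S, w ≠ c → G.Adj c w

/-- `A` and `B` are nonempty unions of components of `G - X` that together make up all of
it, which witnesses that `G - X` is disconnected. -/
structure IsSeparation [Fintype V] [DecidableEq V] (G : SimpleGraph V) (X A B : Finset V) :
    Prop where
  nonempty_left : A.Nonempty
  nonempty_right : B.Nonempty
  disjoint : Disjoint A B
  union_eq : A ∪ B = Xᶜ
  not_adj : ∀ u ∈ A, ∀ v ∈ B, ¬ G.Adj u v

namespace IsSeparation

variable [Fintype V] [DecidableEq V] {X A B : Finset V} {u : V}

theorem symm (h : IsSeparation G X A B) : IsSeparation G X B A where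
  nonempty_left := h.nonempty_right
  nonempty_right := h.nonempty_left
  disjoint := h.disjoint.symm
  union_eq := by rw [union_comm, h.union_eq]
  not_adj u hu v hv huv := h.not_adj v hv u hu huv.symm

theorem notMem_left (h : IsSeparation G X A B) (hu : u ∈ A) : u ∉ X :=
  mem_compl.1 (h.union_eq ▸ mem_union_left B hu)

theorem neighborFinset_subset [DecidableRel G.Adj] (h : IsSeparation G X A B) (hu : u ∈ A) :
    G.neighborFinset u ⊆ A ∪ X := fun v hv => by
  have hvB : v ∉ B := fun hB => h.not_adj u hu v hB (by simpa using hv)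
  have hX := congrArg (v ∈ ·) h.union_eq
  simp only [mem_union, mem_compl, hvB, or_false] at hX
  rw [mem_union, hX]
  exact (em (v ∈ X)).symm

end IsSeparation

theorem exists_isSeparation_of_not_preconnected [Fintype V] [DecidableEq V] {X : Finset V}
    (h : ¬ (G.induce (X : Set V)ᶜ).Preconnected) : ∃ A B, IsSeparation G X A B := by
  classical
  rw [SimpleGraph.Preconnected] at h
  push Not at h
  obtain ⟨a, b, hab⟩ := h
  let A : Finset (↥(X : Set V)ᶜ) := {v | (G.induce (X : Set V)ᶜ).Reachable a v}
  have hA : A.Nonempty := ⟨a, by simp [A]⟩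
  have hA' : Aᶜ.Nonempty := ⟨b, by simpa [A]⟩
  refine ⟨A.map (.subtype _), Aᶜ.map (.subtype _), hA.map, hA'.map, ?_, ?_, ?_⟩
  · exact (disjoint_map _).2 disjoint_compl_right
  · rw [← map_union, union_compl]
    ext
    simp
  · simp only [mem_map, A]
    rintro _ ⟨u, hu, rfl⟩ _ ⟨v, hv, rfl⟩ huv
    simp only [mem_filter, mem_univ, true_and, compl_filter] at hu hv
    exact hv (hu.trans (SimpleGraph.Adj.reachable huv))

theorem cliqueFree_three_of_three_lt_length
    (h : ∀ (v : V) (p : G.Walk v v), Odd p.length → 3 < p.length) : G.CliqueFree 3 := by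
  classical
  rintro s hs
  obtain ⟨a, b, c, hab, hac, hbc, -⟩ := SimpleGraph.is3Clique_iff.1 hs
  simpa using h a (.cons hab (.cons hbc (.cons hac.symm .nil))) (by simp [Nat.odd_iff])

theorem disjoint_neighborFinset_of_adj [Fintype V] [DecidableRel G.Adj] (hG : G.CliqueFree 3)
    {u v : V} (huv : G.Adj u v) : Disjoint (G.neighborFinset u) (G.neighborFinset v) := by
  refine disjoint_left.2 fun w hu hv => ?_
  rw [SimpleGraph.mem_neighborFinset] at hu hv
  exact G.isIndepSet_neighborSet_of_triangleFree hG u huv hu hv.ne hv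

variable [DecidableEq V]

theorem card_le_card_inter_add_card_mul {A N : Finset V} {𝓢 : Finset (Finset V)} {k : ℕ}
    (hN : N ⊆ A ∪ 𝓢.biUnion id) (h : ∀ S ∈ 𝓢, #(N ∩ S) ≤ k) : #N ≤ #(N ∩ A) + #𝓢 * k :=
  calc #N = #(N ∩ A ∪ 𝓢.biUnion fun S => N ∩ S) := by
        rw [← inter_biUnion, ← inter_union_distrib_left]
        exact congrArg card (inter_eq_left.2 hN).symm
    _ ≤ #(N ∩ A) + #𝓢 * k :=
        (card_union_le _ _).trans (Nat.add_le_add_left (card_biUnion_le_card_mul _ _ _ h) _)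

variable [Fintype V] [DecidableRel G.Adj]

namespace IsStarAt

variable {c u v : V} {S : Finset V}

theorem card_neighborFinset_inter_le (hG : G.CliqueFree 3)
    (hcodeg : ∀ u v, u ≠ v → #(G.neighborFinset u ∩ G.neighborFinset v) ≤ 2)
    (hS : IsStarAt G c S) (hu : u ∉ S) : #(G.neighborFinset u ∩ S) ≤ 2 := by
  by_cases hcu : G.Adj u c
  · refine (card_le_card (t := {c}) fun w hw => ?_).trans (by simp)
    rw [mem_inter, SimpleGraph.mem_neighborFinset] at hw
    by_contra hwc
    have hcw := hS.2 w hw.2 (by simpa using hwc)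
    exact disjoint_left.1 (disjoint_neighborFinset_of_adj hG hcu) (by simpa using hw.1)
      (by simpa using hcw)
  · refine (card_le_card fun w hw => ?_).trans (hcodeg u c fun h => hu (h ▸ hS.1))
    rw [mem_inter, SimpleGraph.mem_neighborFinset] at hw
    have hwc : w ≠ c := fun h => hcu (h ▸ hw.1)
    simpa using ⟨hw.1, hS.2 w hw.2 hwc⟩

theorem card_neighborFinset_union_inter_le_of_adj (hG : G.CliqueFree 3)
    (hcodeg : ∀ u v, u ≠ v → #(G.neighborFinset u ∩ G.neighborFinset v) ≤ 2)
    (hS : IsStarAt G c S) (hu : u ∉ S) (hv : v ∉ S) (huv : G.Adj u v) (hcu : G.Adj c u) :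
    #((G.neighborFinset u ∪ G.neighborFinset v) ∩ S) ≤ 2 := by
  -- `u` is a common neighbour of `c` and `v` outside `S`, which leaves at most one inside `S`.
  have hsub : (G.neighborFinset u ∪ G.neighborFinset v) ∩ S ⊆
      insert c ((G.neighborFinset c ∩ G.neighborFinset v).erase u) := fun w hw => by
    rw [mem_inter] at hw
    rw [mem_insert, or_iff_not_imp_left]
    intro hwc
    have hcw := hS.2 w hw.2 hwc
    have huw : w ∉ G.neighborFinset u :=
      disjoint_left.1 (disjoint_neighborFinset_of_adj hG hcu) (by simpa using hcw)
    have hwu : w ≠ u := fun h => hu (h ▸ hw.2)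
    have hvw := (mem_union.1 hw.1).resolve_left huw
    rw [SimpleGraph.mem_neighborFinset] at hvw
    simp [hwu, hcw, hvw]
  have hcv : c ≠ v := fun h => hv (h ▸ hS.1)
  have hu' : u ∈ G.neighborFinset c ∩ G.neighborFinset v := by simp [hcu, huv.symm]
  have h₁ := card_le_card hsub
  have h₂ := card_insert_le c ((G.neighborFinset c ∩ G.neighborFinset v).erase u)
  have h₃ := card_erase_add_one hu'
  have h₄ := hcodeg c v hcv
  lia

theorem card_neighborFinset_union_inter_le
    (hodd : ∀ (v : V) (p : G.Walk v v), Odd p.length → 5 < p.length)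
    (hcodeg : ∀ u v, u ≠ v → #(G.neighborFinset u ∩ G.neighborFinset v) ≤ 2)
    (hS : IsStarAt G c S) (hu : u ∉ S) (hv : v ∉ S) (huv : G.Adj u v) :
    #((G.neighborFinset u ∪ G.neighborFinset v) ∩ S) ≤ 2 := by
  have hG : G.CliqueFree 3 :=
    cliqueFree_three_of_three_lt_length fun v p hp => by have := hodd v p hp; lia
  by_cases hcu : G.Adj c u
  · exact hS.card_neighborFinset_union_inter_le_of_adj hG hcodeg hu hv huv hcu
  by_cases hcv : G.Adj c v
  · rw [union_comm]
    exact hS.card_neighborFinset_union_inter_le_of_adj hG hcodeg hv hu huv.symm hcv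
  have adj_of {x w : V} (hcx : ¬ G.Adj c x) (hw : w ∈ G.neighborFinset x ∩ S) :
      G.Adj x w ∧ G.Adj c w := by
    rw [mem_inter, SimpleGraph.mem_neighborFinset] at hw
    exact ⟨hw.1, hS.2 w hw.2 fun h => hcx (h ▸ hw.1.symm)⟩
  rw [union_inter_distrib_right]
  rcases eq_empty_or_nonempty (G.neighborFinset u ∩ S) with h₀ | ⟨x, hx⟩
  · rw [h₀, empty_union]
    exact hS.card_neighborFinset_inter_le hG hcodeg hv
  rcases eq_empty_or_nonempty (G.neighborFinset v ∩ S) with h₀ | ⟨y, hy⟩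
  · rw [h₀, union_empty]
    exact hS.card_neighborFinset_inter_le hG hcodeg hu
  obtain ⟨hux, hcx⟩ := adj_of hcu hx
  obtain ⟨hvy, hcy⟩ := adj_of hcv hy
  have := hodd c (.cons hcx (.cons hux.symm (.cons huv (.cons hvy (.cons hcy.symm .nil)))))
    (by simp [Nat.odd_iff])
  simp at this

end IsStarAt

theorem two_mul_minDegree_le_card_add
    (hodd : ∀ (v : V) (p : G.Walk v v), Odd p.length → 5 < p.length)
    (hcodeg : ∀ u v, u ≠ v → #(G.neighborFinset u ∩ G.neighborFinset v) ≤ 2)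
    {𝓢 : Finset (Finset V)} (h𝓢 : ∀ S ∈ 𝓢, ∃ c, IsStarAt G c S) (hcard : 2 * #𝓢 < G.minDegree)
    {A B : Finset V} (hsep : IsSeparation G (𝓢.biUnion id) A B) :
    2 * G.minDegree ≤ #A + 2 * #𝓢 := by
  have hG : G.CliqueFree 3 :=
    cliqueFree_three_of_three_lt_length fun v p hp => by have := hodd v p hp; lia
  have notMem {v : V} (hv : v ∈ A) {S : Finset V} (hS : S ∈ 𝓢) : v ∉ S := fun h =>
    hsep.notMem_left hv (mem_biUnion.2 ⟨S, hS, h⟩)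
  have degree_le (v : V) : G.minDegree ≤ #(G.neighborFinset v) := G.minDegree_le_degree v
  obtain ⟨u, hu⟩ := hsep.nonempty_left
  obtain ⟨v, hv⟩ : (G.neighborFinset u ∩ A).Nonempty := by
    have := card_le_card_inter_add_card_mul (hsep.neighborFinset_subset hu) (k := 2) fun S hS =>
      (h𝓢 S hS).elim fun c hc => hc.card_neighborFinset_inter_le hG hcodeg (notMem hu hS)
    have := degree_le u
    rw [← card_pos]
    lia
  obtain ⟨huv, hv⟩ := mem_inter.1 hv
  rw [SimpleGraph.mem_neighborFinset] at huv
  have hpair := card_le_card_inter_add_card_mul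
    (union_subset (hsep.neighborFinset_subset hu) (hsep.neighborFinset_subset hv)) (k := 2)
    fun S hS => (h𝓢 S hS).elim fun c hc =>
      hc.card_neighborFinset_union_inter_le hodd hcodeg (notMem hu hS) (notMem hv hS) huv
  rw [card_union_of_disjoint (disjoint_neighborFinset_of_adj hG huv)] at hpair
  have := card_le_card
    (inter_subset_right (s₁ := G.neighborFinset u ∪ G.neighborFinset v) (s₂ := A))
  have := degree_le u
  have := degree_le v
  lia

end Stars

section StarSubgraphs

open Finset

variable {V W : Type*} {G : SimpleGraph V} {r : ℕ}

theorem starK_isUniversal : (starK r).IsUniversal (Sum.inl 0) := by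
  rintro (i | i) h
  · exact (h (congrArg Sum.inl (Subsingleton.elim 0 i))).elim
  · simp

theorem exists_isUniversal_coe_of_connected {T : (starK r).Subgraph} (hT : T.Connected) :
    ∃ c, T.coe.IsUniversal c := by
  have eq_center {i : Fin r} {x : Fin 1 ⊕ Fin r} (h : T.Adj (Sum.inr i) x) : x = Sum.inl 0 := by
    have := h.adj_sub
    rcases x with x | x
    · rw [Subsingleton.elim x 0]
    · simp at this
  have : Nonempty T.verts := hT.nonempty.to_subtype
  obtain hV | hV := subsingleton_or_nontrivial T.verts
  · exact ⟨Classical.arbitrary _, .of_subsingleton⟩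
  have exists_adj (v : T.verts) : ∃ w, T.Adj v w := hT.preconnected.exists_adj_of_nontrivial v
  have hc : Sum.inl 0 ∈ T.verts := by
    obtain ⟨v | i, hv⟩ := Classical.arbitrary T.verts
    · rwa [Subsingleton.elim v 0] at hv
    · obtain ⟨w, hw⟩ := exists_adj ⟨_, hv⟩
      exact eq_center hw ▸ hw.snd_mem
  refine ⟨⟨_, hc⟩, ?_⟩
  rintro ⟨v | i, hv⟩ hne
  · exact (hne (Subtype.ext (congrArg Sum.inl (Subsingleton.elim 0 v)))).elim
  · obtain ⟨w, hw⟩ := exists_adj ⟨_, hv⟩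
    exact (eq_center hw ▸ hw).symm

theorem IsStructureCut.isSubstructureCut {T : SimpleGraph W} (hT : T.Connected)
    {F : Set G.Subgraph} (h : IsStructureCut G T F) : IsSubstructureCut G T F := by
  refine ⟨fun H hH => ⟨⊤, ?_, ?_⟩, h.2⟩
  · exact SimpleGraph.Subgraph.connected_iff'.2 (SimpleGraph.Subgraph.topIso.connected_iff.2 hT)
  · exact (h.1 H hH).map fun e => e.trans SimpleGraph.Subgraph.topIso.symm

theorem substructureConnectivity_le_structureConnectivity {T : SimpleGraph W} (hT : T.Connected) :
    substructureConnectivity G T ≤ structureConnectivity G T :=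
  sInf_le_sInf fun _ ⟨F, hF, hk⟩ => ⟨F, hF.isSubstructureCut hT, hk⟩

theorem exists_isStarAt_of_iso {H : G.Subgraph} [Fintype H.verts]
    {T : (starK r).Subgraph} (hT : T.Connected) (e : H.coe ≃g T.coe) :
    ∃ c, IsStarAt G c H.verts.toFinset := by
  obtain ⟨c, hc⟩ := exists_isUniversal_coe_of_connected hT
  refine ⟨e.symm c, by simp, fun w hw hwc => ?_⟩
  have hw' : w ∈ H.verts := by simpa using hw
  have : H.coe.Adj (e.symm c) ⟨w, hw'⟩ := by
    rw [← e.map_adj_iff, RelIso.apply_symm_apply]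
    refine hc fun h => hwc ?_
    rw [h, RelIso.symm_apply_apply]
  exact this.adj_sub

theorem card_verts_le_of_iso [Fintype W] {T : SimpleGraph W} {H : G.Subgraph} [Fintype H.verts]
    {T' : T.Subgraph} (e : H.coe ≃g T'.coe) : #H.verts.toFinset ≤ Fintype.card W := by
  classical
  rw [Set.toFinset_card, Fintype.card_congr e.toEquiv]
  exact Fintype.card_subtype_le _

theorem exists_subgraph_iso_starK {c : V} {L : Finset V} (hcL : ∀ v ∈ L, G.Adj c v) :
    ∃ H : G.Subgraph, Nonempty (H.coe ≃g starK #L) ∧ H.verts = insert c (L : Set V) := by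
  let ℓ : Fin #L → V := Subtype.val ∘ L.equivFin.symm
  have hℓ : ℓ.Injective := Subtype.val_injective.comp L.equivFin.symm.injective
  have hcℓ (i) : G.Adj c (ℓ i) := hcL _ (L.equivFin.symm i).2
  let f : Fin 1 ⊕ Fin #L → V := Sum.elim (fun _ => c) ℓ
  have hf : f.Injective :=
    (Function.injective_of_subsingleton _).sumElim hℓ fun _ i => (hcℓ i).ne
  let φ : SimpleGraph.Copy (starK #L) G := ⟨⟨f, by
    rintro (a | i) (b | j) h
    · simp at h
    · exact hcℓ j
    · exact (hcℓ i).symm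
    · simp at h⟩, hf⟩
  refine ⟨φ.toSubgraph, ⟨φ.isoToSubgraph.symm⟩, ?_⟩
  calc φ.toSubgraph.verts = Set.range f := Set.image_univ
    _ = insert c (Set.range ℓ) := by
      rw [Set.Sum.elim_range, Set.range_const, Set.singleton_union]
    _ = insert c (L : Set V) := by rw [EquivLike.range_comp, Subtype.range_coe]

theorem exists_subgraph_iso_starK_of_adj [Fintype V] [DecidableRel G.Adj] (hG : G.CliqueFree 3)
    {u v w c : V} (huv : G.Adj u v) (hvw : v ≠ w) (hcu : c ≠ u) (hcv : G.Adj c v) (hcw : G.Adj c w)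
    (hr : 2 ≤ r) (hdeg : r ≤ G.degree c) :
    ∃ H : G.Subgraph, Nonempty (H.coe ≃g starK r) ∧ u ∉ H.verts ∧ v ∈ H.verts ∧ w ∈ H.verts := by
  classical
  obtain ⟨L, hL, hLc, rfl⟩ := exists_subsuperset_card_eq (s := {v, w}) (t := G.neighborFinset c)
    (by simp [insert_subset_iff, hcv, hcw]) (by rwa [card_pair hvw]) hdeg
  obtain ⟨H, hH, hverts⟩ := exists_subgraph_iso_starK (c := c) (L := L) fun x hx => by
    simpa using hLc hx
  rw [insert_subset_iff, singleton_subset_iff] at hL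
  refine ⟨H, hH, ?_, by simp [hverts, hL.1], by simp [hverts, hL.2]⟩
  rw [hverts, Set.mem_insert_iff, mem_coe, not_or]
  refine ⟨hcu.symm, fun hu => ?_⟩
  exact disjoint_left.1 (disjoint_neighborFinset_of_adj hG hcv) (hLc hu) (by simpa using huv.symm)

theorem not_preconnected_induce_compl [Finite V] {X : Set V} {u : V} (hu : u ∉ X)
    (hnbr : G.neighborSet u ⊆ X) (hX : X.ncard + 1 < Nat.card V) :
    ¬ (G.induce Xᶜ).Preconnected := fun h => by
  obtain ⟨z, hz⟩ : ∃ z, z ∉ insert u X := by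
    rw [← Set.ne_univ_iff_exists_notMem]
    intro h
    rw [← Set.ncard_univ, ← h, Set.ncard_insert_of_notMem hu] at hX
    exact hX.false
  rw [Set.mem_insert_iff, not_or] at hz
  have : Nontrivial ↥Xᶜ := ⟨⟨u, hu⟩, ⟨z, hz.2⟩, fun h => hz.1 (congrArg Subtype.val h).symm⟩
  obtain ⟨w, hw⟩ := h.exists_adj_of_nontrivial ⟨u, hu⟩
  exact w.2 (hnbr hw)

theorem exists_pairing {N : Finset V} (hN : 2 ≤ #N) :
    ∃ a b : Fin ((#N + 1) / 2) → V, (∀ j, a j ∈ N ∧ b j ∈ N ∧ a j ≠ b j) ∧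
      ∀ v ∈ N, ∃ j, v = a j ∨ v = b j := by
  let e : Fin #N ≃ N := N.equivFin.symm
  refine ⟨fun j => e ⟨j, by lia⟩, fun j => e ⟨j + #N / 2, by lia⟩, fun j => ⟨by simp, by simp, ?_⟩,
    fun v hv => ?_⟩
  · intro h
    have := congrArg Fin.val (e.injective (Subtype.ext h))
    dsimp only at this
    lia
  · obtain ⟨i, hi⟩ := e.surjective ⟨v, hv⟩
    have hv : v = e i := by rw [hi]
    by_cases h : i < (#N + 1) / 2
    · exact ⟨⟨i, h⟩, Or.inl hv⟩
    · refine ⟨⟨i - #N / 2, by lia⟩, Or.inr (hv.trans ?_)⟩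
      congr 2
      exact Fin.ext (by dsimp only; lia)

theorem exists_isStructureCut_of_cliqueFree [Fintype V] [DecidableRel G.Adj] (hG : G.CliqueFree 3)
    {u : V} (hcommon : ∀ v w, G.Adj u v → G.Adj u w → v ≠ w → ∃ c ≠ u, G.Adj c v ∧ G.Adj c w)
    (hr : 2 ≤ r) (hdeg : ∀ c, r ≤ G.degree c)
    (hcard : (G.degree u + 1) / 2 * (r + 1) + 1 < Fintype.card V) :
    ∃ F, IsStructureCut G (starK r) F ∧ F.encard ≤ ((G.degree u + 1) / 2 : ℕ) := by
  obtain ⟨a, b, hab, hcover⟩ := exists_pairing (hr.trans (hdeg u))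
  have exists_star (j) : ∃ H : G.Subgraph, Nonempty (H.coe ≃g starK r) ∧ u ∉ H.verts ∧
      a j ∈ H.verts ∧ b j ∈ H.verts := by
    obtain ⟨ha, hb, hne⟩ := hab j
    rw [SimpleGraph.mem_neighborFinset] at ha hb
    obtain ⟨c, hcu, hca, hcb⟩ := hcommon _ _ ha hb hne
    exact exists_subgraph_iso_starK_of_adj hG ha hne hcu hca hcb hr (hdeg c)
  choose H hiso hu ha hb using exists_star
  have hverts : ⋃ K ∈ Set.range H, K.verts = ⋃ j, (H j).verts := Set.biUnion_range
  refine ⟨Set.range H, ⟨by rintro _ ⟨j, rfl⟩; exact hiso j, ?_⟩, ?_⟩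
  · refine not_preconnected_induce_compl (u := u) ?_ (fun v hv => ?_) ?_
    · rw [hverts]
      simpa using hu
    · rw [hverts, Set.mem_iUnion]
      obtain ⟨j, rfl | rfl⟩ := hcover v (by simpa using hv)
      · exact ⟨j, ha j⟩
      · exact ⟨j, hb j⟩
    · have hncard (j) : (H j).verts.ncard = r + 1 := by
        obtain ⟨e⟩ := hiso j
        rw [← Nat.card_coe_set_eq, Nat.card_congr e.toEquiv]
        simp [add_comm]
      have := Set.ncard_iUnion_le_of_fintype fun j => (H j).verts
      simp only [hncard, sum_const, card_univ, Fintype.card_fin, smul_eq_mul] at this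
      rw [hverts, Nat.card_eq_fintype_card]
      exact (Nat.add_le_add_right this 1).trans_lt hcard
  · rw [← Set.image_univ]
    refine (Set.encard_image_le _ _).trans ?_
    simp

end StarSubgraphs

section StarConnectivity

open Finset
open scoped symmDiff

variable {n r : ℕ}

theorem exists_ne_common_neighbor (hn : 0 < n) {u v w : Fin n → Bool}
    (huv : (foldedHypercube n).Adj u v) (huw : (foldedHypercube n).Adj u w) (hvw : v ≠ w) :
    ∃ c ≠ u, (foldedHypercube n).Adj c v ∧ (foldedHypercube n).Adj c w := by
  obtain ⟨s, rfl⟩ := (foldedHypercube_adj_iff_exists hn).1 huv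
  obtain ⟨t, rfl⟩ := (foldedHypercube_adj_iff_exists hn).1 huw
  refine ⟨u ∆ foldedDirection s ∆ foldedDirection t, fun h => hvw ?_,
    (foldedHypercube_adj_iff_exists hn).2 ⟨t, ?_⟩, (foldedHypercube_adj_iff_exists hn).2 ⟨s, ?_⟩⟩
  · rw [← symmDiff_symmDiff_cancel_right (foldedDirection t) (u ∆ foldedDirection s), h]
  · rw [symmDiff_symmDiff_cancel_right]
  · rw [symmDiff_right_comm, symmDiff_symmDiff_cancel_right]

theorem cliqueFree_three_foldedHypercube (hn : 3 ≤ n) : (foldedHypercube n).CliqueFree 3 :=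
  cliqueFree_three_of_three_lt_length fun _ p hp =>
    hn.trans_lt (lt_length_of_odd (by lia) p hp)

theorem half_succ_mul_add_one_lt_two_pow (hn : 5 ≤ n) : (n / 2 + 1) * n + 1 < 2 ^ n := by
  suffices h : n ^ 2 < 2 ^ n by
    refine lt_of_le_of_lt ?_ h
    have : n / 2 + 2 ≤ n := by lia
    nlinarith
  induction n, hn using Nat.le_induction with
  | base => norm_num
  | succ n hn ih =>
    rw [pow_succ 2]
    nlinarith

theorem exists_isStructureCut_foldedHypercube (hn : 5 ≤ n) (hr : 2 ≤ r) (hrn : r < n) :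
    ∃ F, IsStructureCut (foldedHypercube n) (starK r) F ∧ F.encard ≤ (n / 2 + 1 : ℕ) := by
  classical
  have hdeg := isRegularOfDegree_foldedHypercube (n := n) (by lia)
  have hhalf : (n + 1 + 1) / 2 = n / 2 + 1 := by lia
  have h := exists_isStructureCut_of_cliqueFree (cliqueFree_three_foldedHypercube (n := n) (by lia))
    (u := ⊥) (fun v w => exists_ne_common_neighbor (by lia)) hr (fun c => by rw [hdeg c]; lia)
  rw [hdeg ⊥, hhalf] at h
  refine h ?_
  have := Nat.mul_le_mul_left (n / 2 + 1) hrn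
  have := half_succ_mul_add_one_lt_two_pow hn
  rw [Fintype.card_fun, Fintype.card_bool, Fintype.card_fin]
  lia

theorem choose_two_lt_card_of_isSeparation (hn : 5 ≤ n) {𝓢 : Finset (Finset (Fin n → Bool))}
    (h𝓢 : ∀ S ∈ 𝓢, ∃ c, IsStarAt (foldedHypercube n) c S) (hcard : 2 * #𝓢 ≤ n)
    {A B : Finset (Fin n → Bool)}
    (hsep : IsSeparation (foldedHypercube n) (𝓢.biUnion id) A B) :
    n.choose 2 < #(𝓢.biUnion id) := by
  classical
  have hn' : 0 < n := by lia
  have hdeg : (foldedHypercube n).minDegree = n + 1 :=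
    (isRegularOfDegree_foldedHypercube (by lia)).minDegree_eq
  have le_card {A B} (h : IsSeparation (foldedHypercube n) (𝓢.biUnion id) A B) : n + 2 ≤ #A := by
    have := two_mul_minDegree_le_card_add (fun v p hp => hn.trans_lt (lt_length_of_odd hn' p hp))
      (fun u v => card_neighborFinset_inter_le_two hn) h𝓢 (by lia) h
    lia
  have hAB : HammingSeparated A B := fun u hu v hv => by
    have h₀ : hammingDist u v ≠ 0 := hammingDist_ne_zero.2 fun h =>
      disjoint_left.1 hsep.disjoint hu (h ▸ hv)
    have h₁ : hammingDist u v ≠ 1 := fun h =>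
      hsep.not_adj u hu v hv ((foldedHypercube_adj_iff hn').2 (Or.inl h))
    lia
  simpa [hsep.union_eq] using hAB.choose_two_lt_card_separator hn (le_card hsep) (le_card hsep.symm)

theorem half_mul_succ_le_choose_two (hrn : 2 * ((r + 1) / 2) < n) :
    n / 2 * (r + 1) ≤ n.choose 2 := by
  rw [Nat.choose_two_right, Nat.le_div_iff_mul_le two_pos]
  rcases Nat.even_or_odd' n with ⟨m, rfl | rfl⟩
  · calc 2 * m / 2 * (r + 1) * 2 = 2 * m * (r + 1) := by
          rw [Nat.mul_div_cancel_left m two_pos]; ring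
      _ ≤ 2 * m * (2 * m - 1) := Nat.mul_le_mul_left _ (by lia)
  · calc (2 * m + 1) / 2 * (r + 1) * 2 = (r + 1) * (2 * m) := by
          rw [show (2 * m + 1) / 2 = m by lia]; ring
      _ ≤ (2 * m + 1) * (2 * m + 1 - 1) := Nat.mul_le_mul (by lia) (by lia)

theorem lt_encard_of_isSubstructureCut (hn : 5 ≤ n) (hrn : 2 * ((r + 1) / 2) < n)
    {F : Set (foldedHypercube n).Subgraph}
    (hF : IsSubstructureCut (foldedHypercube n) (starK r) F) : (n / 2 : ℕ) < F.encard := by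
  classical
  by_contra! hle
  have hfin := Set.finite_of_encard_le_coe hle
  rw [hfin.encard_eq_coe_toFinset_card, Nat.cast_le] at hle
  let 𝓢 := hfin.toFinset.image fun H => H.verts.toFinset
  have h𝓢 (S) (hS : S ∈ 𝓢) : (∃ c, IsStarAt (foldedHypercube n) c S) ∧ #S ≤ r + 1 := by
    obtain ⟨H, hH, rfl⟩ := mem_image.1 hS
    obtain ⟨T, hT, ⟨e⟩⟩ := hF.1 H (by simpa using hH)
    exact ⟨exists_isStarAt_of_iso hT e, (card_verts_le_of_iso e).trans_eq (by simp [add_comm])⟩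
  have hcard : #𝓢 ≤ n / 2 := card_image_le.trans hle
  have hverts : (𝓢.biUnion id : Set (Fin n → Bool)) = ⋃ H ∈ F, H.verts := by simp [𝓢]
  obtain ⟨A, B, hsep⟩ := exists_isSeparation_of_not_preconnected (X := 𝓢.biUnion id) (by
    rw [hverts]; exact hF.2)
  have := choose_two_lt_card_of_isSeparation hn (fun S hS => (h𝓢 S hS).1) (by lia) hsep
  have := card_biUnion_le_card_mul 𝓢 id (r + 1) fun S hS => (h𝓢 S hS).2
  have := Nat.mul_le_mul_right (r + 1) hcard
  have := half_mul_succ_le_choose_two hrn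
  lia

theorem natCeil_half_succ (n : ℕ) : ⌈((n : ℚ) + 1) / 2⌉₊ = n / 2 + 1 := by
  rw [Nat.ceil_eq_iff (by lia)]
  rcases Nat.even_or_odd' n with ⟨k, rfl | rfl⟩
  · rw [show 2 * k / 2 = k by lia]
    push_cast
    constructor <;> linarith
  · rw [show (2 * k + 1) / 2 = k by lia]
    push_cast
    constructor <;> linarith

theorem six_lt_of_starThreshold_lt (hn : starThreshold r < (n : ℚ)) : 6 < n := by
  have h : (6 : ℚ) ≤ starThreshold r := by
    unfold starThreshold
    split_ifs <;> exact le_max_left _ _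
  exact_mod_cast h.trans_lt hn

theorem two_mul_half_succ_lt_of_starThreshold_lt (hn : starThreshold r < (n : ℚ)) :
    2 * ((r + 1) / 2) < n := by
  have h6 := six_lt_of_starThreshold_lt hn
  unfold starThreshold at hn
  split_ifs at hn with hr
  · simp only [max_lt_iff] at hn
    have h : r ^ 2 + 4 * r < 8 * n + 5 := by
      have : (r : ℚ) ^ 2 + 4 * r < 8 * n + 5 := by linarith [hn.2.2]
      exact_mod_cast this
    obtain ⟨k, rfl⟩ := hr
    by_contra! hle
    have : n ≤ 2 * k + 2 := by lia
    have : 3 ≤ k := by lia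
    nlinarith
  · simp only [max_lt_iff] at hn
    obtain ⟨k, rfl⟩ := Nat.not_odd_iff_even.1 hr
    have h : (k + k) ^ 2 + 6 * (k + k) < 12 * n := by
      have : ((k + k : ℕ) : ℚ) ^ 2 + 6 * (k + k : ℕ) < 12 * n := by linarith [hn.2.2.2]
      exact_mod_cast this
    by_contra! hle
    have : n ≤ 2 * k := by lia
    have : 4 ≤ k := by lia
    nlinarith

end StarConnectivity

theorem theorem5p12_general {r n : ℕ} (hr : 2 ≤ r) (hn : 5 ≤ n) (hrn : 2 * ((r + 1) / 2) < n) :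
    structureConnectivity (foldedHypercube n) (starK r) = ((⌈((n : ℚ) + 1) / 2⌉₊ : ℕ) : ℕ∞) ∧
      substructureConnectivity (foldedHypercube n) (starK r) =
        ((⌈((n : ℚ) + 1) / 2⌉₊ : ℕ) : ℕ∞) := by
  rw [natCeil_half_succ]
  have hle := substructureConnectivity_le_structureConnectivity (G := foldedHypercube n)
    (SimpleGraph.Connected.of_isUniversal (starK_isUniversal (r := r)))
  have lower : (n / 2 + 1 : ℕ) ≤ substructureConnectivity (foldedHypercube n) (starK r) := by
    refine le_sInf ?_
    rintro _ ⟨F, hF, rfl⟩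
    exact Order.add_one_le_of_lt (lt_encard_of_isSubstructureCut hn hrn hF)
  have upper : structureConnectivity (foldedHypercube n) (starK r) ≤ (n / 2 + 1 : ℕ) := by
    obtain ⟨F, hF, hcard⟩ := exists_isStructureCut_foldedHypercube hn hr (r := r) (by lia)
    exact sInf_le_of_le ⟨F, hF, rfl⟩ hcard
  exact ⟨upper.antisymm (lower.trans hle), (hle.trans upper).antisymm lower⟩

theorem theorem5p12 (r n : ℕ) (hr : 2 ≤ r) (hn : starThreshold r < (n : ℚ)) :
    structureConnectivity (foldedHypercube n) (starK r) = ((⌈((n : ℚ) + 1) / 2⌉₊ : ℕ) : ℕ∞) ∧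
      substructureConnectivity (foldedHypercube n) (starK r) =
        ((⌈((n : ℚ) + 1) / 2⌉₊ : ℕ) : ℕ∞) :=
  theorem5p12_general hr (by have := six_lt_of_starThreshold_lt hn; lia)
    (two_mul_half_succ_lt_of_starThreshold_lt hn)
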